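/- Let $K$ be a field, let $S=K[t_1,\ldots,t_s]$, and let $I\subset S$ be a squarefree monomial ideal with $I\neq(0)$ and $I\neq S$. Let $G(I)=\{t^{v_1},\ldots,t^{v_q}\}$ be the minimal set of monomial generators of $I$ (each $v_k\in\{0,1\}^s$), and let $\mathcal{C}$ be the clutter on $\{t_1,\ldots,t_s\}$ whose edges are the supports of these generators, so that $I$ is the edge ideal of $\mathcal{C}$. The Alexander dual $I^\vee$ of $I$ is the ideal generated by the monomials $\prod_{t_i\in C}t_i$, where $C$ runs over the minimal vertex covers of $\mathcal{C}$. The covering polyhedron of $I$ is $$\mathcal{Q}(I)=\{x\in\mathbb{R}^s\mid x\geq 0,\ \langle x,v_k\rangle\geq 1\mbox{ for }k=1,\ldots,q\},$$ and $V(\mathcal{Q}(I))$ denotes its set of vertices; $\mathcal{Q}(I^\vee)$ and $V(\mathcal{Q}(I^\vee))$ are defined in the same way from $I^\vee$. For $n\geq 1$, the $n$-th symbolic power of an ideal $J\subset S$ is $J^{(n)}=\bigcap_{\mathfrak p}(J^nS_{\mathfrak p}\cap S)$, where $\mathfrak p$ runs over the minimal primes of $J$; $\overline{J^{r}}$ is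 the integral closure of $J^r$; and the ic-resurgence of $J$ is $$\rho_{ic}(J)=\sup\left\{\frac{n}{r}\ \middle|\ n,r\geq 1\mbox{ integers},\ J^{(n)}\not\subset\overline{J^{r}}\right\}.$$ Theorem (Duality formula). The suprema $\rho_{ic}(I)$ and $\rho_{ic}(I^\vee)$ are finite suprema of nonempty sets, and $$\frac{1}{\rho_{ic}(I)}=\min\left\{\langle u,v\rangle\mid u\in V(\mathcal{Q}(I)),\ v\in V(\mathcal{Q}(I^\vee))\right\}.$$ In particular, $\rho_{ic}(I)=\rho_{ic}(I^\vee)$. -/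

import Mathlib

open MvPolynomial

/-- A clutter on the vertex set `σ`: a family of subsets (edges), none of which is contained in
another one. -/
structure Clutter (σ : Type*) where
  edges : Set (Finset σ)
  antichain : IsAntichain (· ⊆ ·) edges

/-- `U` is a vertex cover of `C`: every edge contains a vertex of `U`. -/
def Clutter.IsVertexCover {σ : Type*} (C : Clutter σ) (U : Finset σ) : Prop :=
  ∀ e ∈ C.edges, ∃ i ∈ e, i ∈ U

/-- The blocker of `C`: the clutter of minimal vertex covers of `C`. -/
def Clutter.blocker {σ : Type*} (C : Clutter σ) : Clutter σ where
  edges := {U | Minimal C.IsVertexCover U}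
  antichain := setOfPred_minimal_antichain _

/-- The squarefree monomial `t_e = ∏_{i ∈ e} t_i`. -/
noncomputable def squarefreeMonomial {σ : Type*} (K : Type*) [CommSemiring K] (e : Finset σ) :
    MvPolynomial σ K :=
  ∏ i ∈ e, X i

/-- The edge ideal of a clutter. -/
noncomputable def Clutter.edgeIdeal {σ : Type*} (K : Type*) [CommSemiring K] (C : Clutter σ) :
    Ideal (MvPolynomial σ K) :=
  Ideal.span (squarefreeMonomial K '' C.edges)

namespace Ideal

/-- `I` is generated by squarefree monomials. -/
def IsSquarefreeMonomial {σ K : Type*} [CommSemiring K] (I : Ideal (MvPolynomial σ K)) : Prop :=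
  ∃ E : Set (Finset σ), I = Ideal.span (squarefreeMonomial K '' E)

/-- The clutter whose edges are the supports of the minimal squarefree monomials in `I`. When `I`
is a squarefree monomial ideal these monomials are its minimal monomial generators. -/
def clutter {σ K : Type*} [CommSemiring K] (I : Ideal (MvPolynomial σ K)) : Clutter σ where
  edges := {e | Minimal (fun e' : Finset σ => squarefreeMonomial K e' ∈ I) e}
  antichain := setOfPred_minimal_antichain _

/-- The Alexander dual `I^∨` of a squarefree monomial ideal: the edge ideal of the blocker of the
clutter of `I`. -/
noncomputable def alexanderDual {σ K : Type*} [CommSemiring K] (I : Ideal (MvPolynomial σ K)) :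
    Ideal (MvPolynomial σ K) :=
  I.clutter.blocker.edgeIdeal K

/-- The covering polyhedron `{x ∣ x ≥ 0, xA ≥ 1}` of a squarefree monomial ideal `I`, where the
columns of `A` are the exponents (characteristic vectors of edges) of its minimal generators. -/
def coveringPolyhedron {σ K : Type*} [CommSemiring K] (I : Ideal (MvPolynomial σ K)) :
    Set (σ → ℝ) :=
  {x | (∀ i, 0 ≤ x i) ∧ ∀ e ∈ I.clutter.edges, 1 ≤ ∑ i ∈ e, x i}

/-- The vertices of the covering polyhedron. -/
def coveringVertices {σ K : Type*} [CommSemiring K] (I : Ideal (MvPolynomial σ K)) :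
    Set (σ → ℝ) :=
  I.coveringPolyhedron.extremePoints ℝ

/-- The `n`-th symbolic power of `I`: the intersection, over the minimal primes `p` of `I`, of the
contractions `Iⁿ R_p ∩ R`. Here `x` lies in `Iⁿ R_p ∩ R` iff `g * x ∈ Iⁿ` for some `g ∉ p`. -/
def symbolicPower {R : Type*} [CommRing R] (I : Ideal R) (n : ℕ) : Ideal R where
  carrier := {x | ∀ p ∈ I.minimalPrimes, ∃ g, g ∉ p ∧ g * x ∈ I ^ n}
  zero_mem' := fun p hp => ⟨1, (Ideal.ne_top_iff_one p).mp hp.1.1.ne_top, by simp⟩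
  add_mem' := by
    intro x y hx hy p hp
    obtain ⟨g, hg, hgx⟩ := hx p hp
    obtain ⟨h, hh, hhy⟩ := hy p hp
    refine ⟨g * h, fun H => (hp.1.1.mem_or_mem H).elim hg hh, ?_⟩
    have e : g * h * (x + y) = h * (g * x) + g * (h * y) := by ring
    rw [e]
    exact add_mem (Ideal.mul_mem_left _ _ hgx) (Ideal.mul_mem_left _ _ hhy)
  smul_mem' := by
    intro c x hx p hp
    obtain ⟨g, hg, hgx⟩ := hx p hp
    refine ⟨g, hg, ?_⟩
    have e : g * (c • x) = c * (g * x) := by simp only [smul_eq_mul]; ring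
    rw [e]
    exact Ideal.mul_mem_left _ _ hgx

/-- The integral closure of an ideal `J`: all `x` satisfying an equation of integral dependence
`x ^ m + a₁ x ^ (m - 1) + ⋯ + aₘ = 0` with `m ≥ 1` and `aᵢ ∈ J ^ i`. -/
def integralClosureSet {R : Type*} [CommRing R] (J : Ideal R) : Set R :=
  {x | ∃ (m : ℕ) (a : ℕ → R), 1 ≤ m ∧ (∀ i ∈ Finset.Icc 1 m, a i ∈ J ^ i) ∧
    x ^ m + ∑ i ∈ Finset.Icc 1 m, a i * x ^ (m - i) = 0}

/-- The set of ratios `n / r` of positive integers such that the `n`-th symbolic power of `I` is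
not contained in the integral closure of `I ^ r`. -/
def icRatios {R : Type*} [CommRing R] (I : Ideal R) : Set ℝ :=
  {q | ∃ n r : ℕ, 1 ≤ n ∧ 1 ≤ r ∧ ¬ ((I.symbolicPower n : Set R) ⊆ (I ^ r).integralClosureSet) ∧
    q = (n : ℝ) / (r : ℝ)}

/-- The ic-resurgence of `I`. -/
noncomputable def icResurgence {R : Type*} [CommRing R] (I : Ideal R) : ℝ :=
  sSup I.icRatios

end Ideal

/-!
# The duality formula for the ic-resurgence of squarefree monomial ideals

Let `C` be the clutter of `I` and `B` its blocker, with covering polyhedra `Q(C)` and `Q(B)`, and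
let `m` be the infimum of `⟨u, v⟩` over `u ∈ Q(C)` and `v ∈ Q(B)`. Both families of ideals in the
definition of the ic-resurgence are described by linear inequalities on exponents.

* A monomial `t^b` lies in `I^(n)` iff `∑ i ∈ U, b i ≥ n` for all minimal vertex covers `U`, that
  is, iff `b / n ∈ Q(B)`. The minimal primes of `I` are generated by the minimal vertex covers, and
  the order along such a prime is a valuation (`mem_weightIdeal_of_mem_symbolicPower`,
  `monomial_mem_symbolicPower`).
* A monomial `t^b` lies in the integral closure of `I^r` iff `⟨b, u⟩ ≥ r` for all `u ∈ Q(C)`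
  (`le_expWeight_of_mem_integralClosureSet`, `mem_integralClosureSet_edgeIdeal_pow`). For the
  sufficiency, Hahn-Banach separation writes `b` as at least a real nonnegative combination of edges
  of total weight `r`. Rounding it down costs a factor `c`, the product of all edge monomials, which
  does not depend on the exponents. Hence `c * f ^ k ∈ (I^r)^k` for all `k`, so `f` is integral over
  `I^r` because the polynomial ring is a Noetherian domain
  (`Ideal.mem_integralClosureSet_of_forall_mul_pow_mem`). No rationality of vertices is needed.

Thus `I^(n)` is not contained in the integral closure of `I^r` only if some `y = b / n ∈ Q(B)` and
`u ∈ Q(C)` satisfy `⟨y, u⟩ < r / n`, which gives `n / r < 1 / m`. Rounding up large multiples of an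
optimal `v ∈ Q(B)` gives ratios tending to `1 / m` (`exists_mem_icRatios_gt`).

The infimum `m` is positive since the support of a fractional cover is a cover (`sum_mul_pos`). It
is attained, at a pair of vertices, because truncating at `1` preserves the polyhedra and because a
linear functional with nonnegative coefficients attains its minimum at a vertex
(`exists_extremePoints_forall_sum_le`). The equality of the two resurgences follows from the
symmetry of the pairing and from `blocker_blocker`.
-/

/-! ### The covering polyhedron of a clutter -/

namespace Clutter

variable {σ : Type*}

/-- The covering polyhedron of a clutter: the nonnegative weightings of the vertices that give
every edge total weight at least `1`. -/
def coveringPolyhedron (C : Clutter σ) : Set (σ → ℝ) :=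
  {x | (∀ i, 0 ≤ x i) ∧ ∀ e ∈ C.edges, 1 ≤ ∑ i ∈ e, x i}

theorem isClosed_coveringPolyhedron (C : Clutter σ) : IsClosed C.coveringPolyhedron := by
  have h : C.coveringPolyhedron =
      (⋂ i, {x | 0 ≤ x i}) ∩ ⋂ e ∈ C.edges, {x : σ → ℝ | 1 ≤ ∑ i ∈ e, x i} := by
    ext x
    simp [coveringPolyhedron]
  rw [h]
  refine IsClosed.inter (isClosed_iInter fun i => isClosed_le (by fun_prop) (by fun_prop)) ?_
  exact isClosed_biInter fun e _ => isClosed_le (by fun_prop) (by fun_prop)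

/-- Truncating a fractional cover at height `1` yields a fractional cover, since the constraints
have coefficients `0` and `1`. -/
theorem truncate_mem_coveringPolyhedron {C : Clutter σ} {x : σ → ℝ}
    (hx : x ∈ C.coveringPolyhedron) : (fun i => min (x i) 1) ∈ C.coveringPolyhedron := by
  refine ⟨fun i => le_min (hx.1 i) zero_le_one, fun e he => ?_⟩
  by_cases h : ∃ i ∈ e, 1 ≤ x i
  · obtain ⟨i, hi, h1⟩ := h
    calc (1 : ℝ) = min (x i) 1 := (min_eq_right h1).symm
      _ ≤ _ := Finset.single_le_sum (f := fun i => min (x i) 1)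
        (fun j _ => le_min (hx.1 j) zero_le_one) hi
  · push Not at h
    refine (hx.2 e he).trans_eq (Finset.sum_congr rfl fun i hi => ?_)
    exact (min_eq_left (h i hi).le).symm

/-- The fractional covers with all weights at most `1`. -/
def coveringPolytope (C : Clutter σ) : Set (σ → ℝ) :=
  C.coveringPolyhedron ∩ Set.Icc 0 1

theorem isCompact_coveringPolytope (C : Clutter σ) : IsCompact C.coveringPolytope :=
  isCompact_Icc.inter_left C.isClosed_coveringPolyhedron

theorem truncate_mem_coveringPolytope {C : Clutter σ} {x : σ → ℝ}
    (hx : x ∈ C.coveringPolyhedron) : (fun i => min (x i) 1) ∈ C.coveringPolytope :=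
  ⟨truncate_mem_coveringPolyhedron hx, fun i => le_min (hx.1 i) zero_le_one,
    fun _ => min_le_right _ _⟩

theorem coveringPolytope_nonempty {C : Clutter σ} (hC : ∅ ∉ C.edges) :
    C.coveringPolytope.Nonempty := by
  refine ⟨1, ⟨fun i => zero_le_one, fun e he => ?_⟩, zero_le_one, le_rfl⟩
  have : e.Nonempty := Finset.nonempty_iff_ne_empty.mpr fun h => hC (h ▸ he)
  simpa using this

variable [Fintype σ]

theorem sum_truncate_mul_le {v : σ → ℝ} (hv : ∀ i, 0 ≤ v i) (x : σ → ℝ) :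
    ∑ i, min (x i) 1 * v i ≤ ∑ i, x i * v i :=
  Finset.sum_le_sum fun i _ => mul_le_mul_of_nonneg_right (min_le_left _ _) (hv i)

/-- A nonnegative linear functional attains its minimum over the covering polyhedron at a vertex.
The vertex is an extreme point of the set of those minimizers in the unit cube that have the least
coordinate sum: this second minimization keeps the point from splitting along the recession cone. -/
theorem exists_extremePoint_forall_sum_le {C : Clutter σ} (hC : ∅ ∉ C.edges) {v : σ → ℝ}
    (hv : ∀ i, 0 ≤ v i) : ∃ u ∈ C.coveringPolyhedron.extremePoints ℝ,
      ∀ x ∈ C.coveringPolyhedron, ∑ i, u i * v i ≤ ∑ i, x i * v i := by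
  obtain ⟨p, hpK, hp⟩ := C.isCompact_coveringPolytope.exists_isMinOn
    (coveringPolytope_nonempty hC) (f := fun x => ∑ i, x i * v i) (by fun_prop)
  have hpmin : ∀ x ∈ C.coveringPolyhedron, ∑ i, p i * v i ≤ ∑ i, x i * v i := fun x hx =>
    (isMinOn_iff.mp hp _ (truncate_mem_coveringPolytope hx)).trans (sum_truncate_mul_le hv x)
  set F := C.coveringPolytope ∩ {x | ∑ i, x i * v i = ∑ i, p i * v i} with hF
  have hFc : IsCompact F :=
    C.isCompact_coveringPolytope.inter_right (isClosed_eq (by fun_prop) (by fun_prop))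
  obtain ⟨q, hqF, hq⟩ := hFc.exists_isMinOn ⟨p, hpK, rfl⟩ (f := fun x => ∑ i, x i) (by fun_prop)
  set G := F ∩ {x | ∑ i, x i = ∑ i, q i} with hG
  have hGc : IsCompact G := hFc.inter_right (isClosed_eq (by fun_prop) (by fun_prop))
  obtain ⟨u, hu⟩ := hGc.extremePoints_nonempty ⟨q, hqF, rfl⟩
  have huG := hu.1
  refine ⟨u, mem_extremePoints.mpr ⟨huG.1.1.1, fun x hx y hy hxy => ?_⟩, fun x hx => ?_⟩
  · obtain ⟨a, b, ha, hb, hab, hsum⟩ := hxy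
    have expand : ∀ w : σ → ℝ, a * ∑ i, x i * w i + b * ∑ i, y i * w i = ∑ i, u i * w i := by
      intro w
      rw [← hsum, Finset.mul_sum, Finset.mul_sum, ← Finset.sum_add_distrib]
      refine Finset.sum_congr rfl fun i _ => ?_
      simp only [Pi.add_apply, Pi.smul_apply, smul_eq_mul]
      ring
    -- both endpoints minimize the functional, because the interior point `u` does
    have huv : ∑ i, u i * v i = ∑ i, p i * v i := huG.1.2
    have hxv : ∑ i, x i * v i = ∑ i, p i * v i := by
      refine le_antisymm (le_of_mul_le_mul_left ?_ ha) (hpmin x hx)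
      have h1 := mul_le_mul_of_nonneg_left (hpmin y hy) hb.le
      have h2 := expand v
      have h3 : a = 1 - b := by linarith
      rw [huv] at h2
      subst h3
      linarith
    have hyv : ∑ i, y i * v i = ∑ i, p i * v i := by
      refine le_antisymm (le_of_mul_le_mul_left ?_ hb) (hpmin y hy)
      have h1 := mul_le_mul_of_nonneg_left (hpmin x hx) ha.le
      have h2 := expand v
      have h3 : b = 1 - a := by linarith
      rw [huv] at h2
      subst h3
      linarith
    have trunc_mem : ∀ z ∈ C.coveringPolyhedron, ∑ i, z i * v i = ∑ i, p i * v i →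
        (fun i => min (z i) 1) ∈ F := fun z hz hzv =>
      ⟨truncate_mem_coveringPolytope hz, le_antisymm ((sum_truncate_mul_le hv z).trans_eq hzv)
        (hpmin _ (truncate_mem_coveringPolyhedron hz))⟩
    have sum_ge : ∀ z ∈ C.coveringPolyhedron, ∑ i, z i * v i = ∑ i, p i * v i →
        ∑ i, q i ≤ ∑ i, min (z i) 1 := fun z hz hzv =>
      isMinOn_iff.mp hq _ (trunc_mem z hz hzv)
    have trunc_le : ∀ z : σ → ℝ, ∑ i, min (z i) 1 ≤ ∑ i, z i := fun z =>
      Finset.sum_le_sum fun i _ => min_le_left _ _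
    have hu1 : ∑ i, u i = ∑ i, q i := huG.2
    have hsum1 := expand 1
    simp only [Pi.one_apply, mul_one, hu1] at hsum1
    have hx1 : ∑ i, x i = ∑ i, q i := by
      refine le_antisymm (le_of_mul_le_mul_left ?_ ha) ((sum_ge x hx hxv).trans (trunc_le x))
      have h1 := mul_le_mul_of_nonneg_left ((sum_ge y hy hyv).trans (trunc_le y)) hb.le
      have h3 : a = 1 - b := by linarith
      subst h3
      linarith
    have hy1 : ∑ i, y i = ∑ i, q i := by
      refine le_antisymm (le_of_mul_le_mul_left ?_ hb) ((sum_ge y hy hyv).trans (trunc_le y))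
      have h1 := mul_le_mul_of_nonneg_left ((sum_ge x hx hxv).trans (trunc_le x)) ha.le
      have h3 : b = 1 - a := by linarith
      subst h3
      linarith
    have mem_G : ∀ z ∈ C.coveringPolyhedron, ∑ i, z i * v i = ∑ i, p i * v i →
        ∑ i, z i = ∑ i, q i → z ∈ G := by
      intro z hz hzv hz1
      have heq : ∑ i, min (z i) 1 = ∑ i, z i :=
        le_antisymm (trunc_le z) (hz1.trans_le (sum_ge z hz hzv))
      have hall := (Finset.sum_eq_sum_iff_of_le fun i _ => min_le_left (z i) 1).mp heq
      have hz' : (fun i => min (z i) 1) = z := funext fun i => hall i (Finset.mem_univ i)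
      exact ⟨hz' ▸ trunc_mem z hz hzv, hz1⟩
    exact (mem_extremePoints.mp hu).2 x (mem_G x hx hxv hx1) y (mem_G y hy hyv hy1)
      ⟨a, b, ha, hb, hab, hsum⟩
  · exact (huG.1.2 : _ = _).trans_le (hpmin x hx)

/-- The pairing of the covering polyhedra of two clutters attains its minimum at a pair of
vertices. -/
theorem exists_extremePoints_forall_sum_le {C D : Clutter σ} (hC : ∅ ∉ C.edges)
    (hD : ∅ ∉ D.edges) : ∃ u ∈ C.coveringPolyhedron.extremePoints ℝ,
      ∃ v ∈ D.coveringPolyhedron.extremePoints ℝ,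
      ∀ x ∈ C.coveringPolyhedron, ∀ y ∈ D.coveringPolyhedron,
        ∑ i, u i * v i ≤ ∑ i, x i * y i := by
  obtain ⟨⟨p, q⟩, ⟨hp, hq⟩, hpq⟩ :=
    (C.isCompact_coveringPolytope.prod D.isCompact_coveringPolytope).exists_isMinOn
      ((coveringPolytope_nonempty hC).prod (coveringPolytope_nonempty hD))
      (f := fun z => ∑ i, z.1 i * z.2 i) (by fun_prop)
  obtain ⟨u, hu, humin⟩ := exists_extremePoint_forall_sum_le hC hq.1.1
  obtain ⟨v, hv, hvmin⟩ := exists_extremePoint_forall_sum_le hD hu.1.1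
  refine ⟨u, hu, v, hv, fun x hx y hy => ?_⟩
  have h1 : ∑ i, u i * v i ≤ ∑ i, u i * q i := by
    simpa only [mul_comm (u _)] using hvmin q hq.1
  refine h1.trans ((humin p hp.1).trans ?_)
  refine (isMinOn_iff.mp hpq (_, _)
    ⟨truncate_mem_coveringPolytope hx, truncate_mem_coveringPolytope hy⟩).trans ?_
  exact Finset.sum_le_sum fun i _ => mul_le_mul (min_le_left _ _) (min_le_left _ _)
    (le_min (hy.1 i) zero_le_one) (hx.1 i)

end Clutter

/-! ### Blockers -/

namespace Clutter

section Blocker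

variable {σ : Type*}

theorem eq_of_edges_eq {C D : Clutter σ} (h : C.edges = D.edges) : C = D := by
  cases C
  cases D
  congr

theorem IsVertexCover.exists_blocker_subset {C : Clutter σ} {U : Finset σ}
    (hU : C.IsVertexCover U) : ∃ V ∈ C.blocker.edges, V ⊆ U := by
  obtain ⟨V, hVU, hV⟩ := exists_minimal_le_of_wellFoundedLT C.IsVertexCover U hU
  exact ⟨V, hV, hVU⟩

/-- Each vertex of a minimal vertex cover is the only point of the cover on some edge. -/
theorem exists_edge_inter_eq_of_mem_blocker {C : Clutter σ} {U : Finset σ}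
    (hU : U ∈ C.blocker.edges) {i : σ} (hi : i ∈ U) :
    ∃ e ∈ C.edges, i ∈ e ∧ ∀ j ∈ e, j ∈ U → j = i := by
  classical
  by_contra! h
  have hcov : C.IsVertexCover (U.erase i) := by
    intro e he
    obtain ⟨j, hje, hjU⟩ := hU.1 e he
    by_cases hie : i ∈ e
    · obtain ⟨k, hke, hkU, hki⟩ := h e he hie
      exact ⟨k, hke, Finset.mem_erase.mpr ⟨hki, hkU⟩⟩
    · exact ⟨j, hje, Finset.mem_erase.mpr ⟨fun hji => hie (hji ▸ hje), hjU⟩⟩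
  exact Finset.notMem_erase i U (hU.2 hcov (Finset.erase_subset i U) hi)

theorem empty_notMem_blocker_edges {C : Clutter σ} (hC : C.edges.Nonempty) :
    ∅ ∉ C.blocker.edges := by
  intro h
  obtain ⟨e, he⟩ := hC
  obtain ⟨i, -, hi⟩ := h.1 e he
  exact Finset.notMem_empty i hi

variable [Fintype σ]

theorem blocker_edges_nonempty {C : Clutter σ} (hC : ∅ ∉ C.edges) :
    C.blocker.edges.Nonempty := by
  have : C.IsVertexCover Finset.univ := by
    intro e he
    obtain ⟨i, hi⟩ := Finset.nonempty_iff_ne_empty.mpr fun h => hC (h ▸ he)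
    exact ⟨i, hi, Finset.mem_univ i⟩
  obtain ⟨V, hV, -⟩ := this.exists_blocker_subset
  exact ⟨V, hV⟩

/-- The vertex covers of the blocker are the sets that contain an edge. -/
theorem isVertexCover_blocker_iff {C : Clutter σ} {U : Finset σ} :
    C.blocker.IsVertexCover U ↔ ∃ e ∈ C.edges, e ⊆ U := by
  classical
  constructor
  · intro h
    by_contra! hU
    -- otherwise the complement of `U` is a vertex cover
    have hcov : C.IsVertexCover Uᶜ := by
      intro e he
      obtain ⟨i, hie, hiU⟩ := Finset.not_subset.mp (hU e he)
      exact ⟨i, hie, Finset.mem_compl.mpr hiU⟩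
    obtain ⟨V, hV, hVU⟩ := hcov.exists_blocker_subset
    obtain ⟨i, hiV, hiU⟩ := h V hV
    exact Finset.mem_compl.mp (hVU hiV) hiU
  · rintro ⟨e, he, heU⟩ V hV
    obtain ⟨i, hie, hiV⟩ := hV.1 e he
    exact ⟨i, hiV, heU hie⟩

/-- A set of sets that contain a member of an antichain has that antichain as its minimal
elements. -/
theorem minimal_exists_edge_subset_iff {τ : Type*} {C : Clutter τ} {U : Finset τ} :
    Minimal (fun V : Finset τ => ∃ e ∈ C.edges, e ⊆ V) U ↔ U ∈ C.edges := by
  constructor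
  · rintro ⟨⟨e, he, heU⟩, hmin⟩
    have : U ⊆ e := hmin ⟨e, he, subset_rfl⟩ heU
    exact subset_antisymm heU this ▸ he
  · refine fun hU => ⟨⟨U, hU, subset_rfl⟩, ?_⟩
    rintro V ⟨e, he, heV⟩ hVU
    have : e = U := C.antichain.eq he hU (heV.trans hVU)
    exact this ▸ heV

theorem blocker_blocker (C : Clutter σ) : C.blocker.blocker = C := by
  refine eq_of_edges_eq (Set.ext fun U => ?_)
  change Minimal C.blocker.IsVertexCover U ↔ _
  have hP : C.blocker.IsVertexCover = fun V => ∃ e ∈ C.edges, e ⊆ V :=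
    funext fun V => propext isVertexCover_blocker_iff
  rw [hP, minimal_exists_edge_subset_iff]

/-- The support of a fractional vertex cover is a vertex cover, so it meets the support of every
fractional cover of the blocker. -/
theorem sum_mul_pos {C : Clutter σ} {u v : σ → ℝ} (hu : u ∈ C.coveringPolyhedron)
    (hv : v ∈ C.blocker.coveringPolyhedron) : 0 < ∑ i, u i * v i := by
  classical
  have hcov : C.IsVertexCover (Finset.univ.filter fun i => 0 < u i) := by
    intro e he
    have : 0 < ∑ i ∈ e, u i := zero_lt_one.trans_le (hu.2 e he)
    obtain ⟨i, hi, h⟩ := Finset.exists_lt_of_sum_lt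
      (show ∑ i ∈ e, (0 : ℝ) < ∑ i ∈ e, u i by simpa using this)
    exact ⟨i, hi, by simpa using h⟩
  obtain ⟨V, hV, hVU⟩ := hcov.exists_blocker_subset
  have : 0 < ∑ i ∈ V, v i := zero_lt_one.trans_le (hv.2 V hV)
  obtain ⟨i, hi, h⟩ := Finset.exists_lt_of_sum_lt
    (show ∑ i ∈ V, (0 : ℝ) < ∑ i ∈ V, v i by simpa using this)
  refine Finset.sum_pos' (fun j _ => mul_nonneg (hu.1 j) (hv.1 j)) ⟨i, Finset.mem_univ i, ?_⟩
  exact mul_pos (by simpa using hVU hi) h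

end Blocker

/-! ### Linear programming duality for the covering polyhedron -/

open scoped Pointwise

open Classical in
/-- The linear map sending a weighting `w` of the sets of vertices to `∑ e, w e • 𝟙_e`. -/
noncomputable def loadMap (σ : Type*) [Fintype σ] : (Finset σ → ℝ) →ₗ[ℝ] (σ → ℝ) where
  toFun w i := ∑ e, if i ∈ e then w e else 0
  map_add' x y := by
    ext i
    simp only [Pi.add_apply, ← Finset.sum_add_distrib]
    exact Finset.sum_congr rfl fun e _ => by split_ifs <;> simp
  map_smul' c x := by
    ext i
    simp only [Pi.smul_apply, smul_eq_mul, RingHom.id_apply, Finset.mul_sum]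
    exact Finset.sum_congr rfl fun e _ => by split_ifs <;> simp

/-- The Newton polyhedron of a clutter: the convex hull of the characteristic vectors of the edges
plus the nonnegative orthant. -/
def newtonPolyhedron {σ : Type*} [Fintype σ] (C : Clutter σ) : Set (σ → ℝ) :=
  loadMap σ '' (stdSimplex ℝ (Finset σ) ∩ {w | ∀ e ∉ C.edges, w e = 0}) + Set.Ici 0

section Duality

variable {σ : Type*} [Fintype σ]

theorem convex_newtonPolyhedron (C : Clutter σ) : Convex ℝ C.newtonPolyhedron := by
  refine (((convex_stdSimplex ℝ _).inter ?_).linear_image _).add (convex_Ici 0)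
  intro x hx y hy a b _ _ _ e he
  simp [hx e he, hy e he]

theorem isClosed_newtonPolyhedron (C : Clutter σ) : IsClosed C.newtonPolyhedron := by
  refine IsClosed.add_left_of_isCompact isClosed_Ici (IsCompact.image ?_
    (LinearMap.continuous_on_pi _))
  refine (isCompact_stdSimplex ℝ _).inter_right ?_
  simp only [Set.ofPred_forall]
  exact isClosed_iInter fun e => isClosed_iInter fun _ => isClosed_eq (by fun_prop) (by fun_prop)

theorem indicator_add_mem_newtonPolyhedron {C : Clutter σ} {e : Finset σ} (he : e ∈ C.edges)
    {x : σ → ℝ} (hx : 0 ≤ x) :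
    (fun i => by classical exact if i ∈ e then (1 : ℝ) else 0) + x ∈ C.newtonPolyhedron := by
  classical
  refine Set.add_mem_add ⟨Pi.single e 1, ⟨single_mem_stdSimplex ℝ e, fun e' he' => ?_⟩, ?_⟩ hx
  · exact Pi.single_eq_of_ne (fun h : e' = e => he' (h ▸ he)) _
  · ext i
    simp only [loadMap, LinearMap.coe_mk, AddHom.coe_mk]
    rw [Finset.sum_eq_single e]
    · simp
    · intro e' _ hne
      simp [Pi.single_eq_of_ne hne]
    · simp

/-- The blocking-type duality between the Newton polyhedron and the covering polyhedron: a
nonnegative vector pairing to at least `1` with all fractional covers lies in the Newton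
polyhedron. A separating hyperplane would be, after scaling, a fractional cover. -/
theorem mem_newtonPolyhedron {C : Clutter σ} (hC : C.edges.Nonempty) {a : σ → ℝ} (ha : 0 ≤ a)
    (h : ∀ u ∈ C.coveringPolyhedron, 1 ≤ ∑ i, a i * u i) : a ∈ C.newtonPolyhedron := by
  classical
  by_contra hN
  obtain ⟨f, s, hfa, hfs⟩ := geometric_hahn_banach_point_closed C.convex_newtonPolyhedron
    C.isClosed_newtonPolyhedron hN
  set u : σ → ℝ := fun i => f (Pi.single i 1) with hu
  have hf : ∀ x : σ → ℝ, f x = ∑ i, x i * u i := by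
    intro x
    conv_lhs => rw [← Finset.univ_sum_single x]
    rw [map_sum]
    refine Finset.sum_congr rfl fun i _ => ?_
    have : Pi.single i (x i) = x i • (Pi.single i 1 : σ → ℝ) := by
      rw [← Pi.single_smul, smul_eq_mul, mul_one]
    rw [this, map_smul, smul_eq_mul]
  obtain ⟨e₀, he₀⟩ := hC
  have hu0 : ∀ i, 0 ≤ u i := by
    intro i
    by_contra! hi
    -- moving far in direction `i` stays in the polyhedron but makes `f` smaller than `s`
    obtain ⟨y, hy⟩ : ∃ y : σ → ℝ, y = fun i => if i ∈ e₀ then (1 : ℝ) else 0 := ⟨_, rfl⟩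
    have key : ∀ t : ℝ, 0 ≤ t → s < f y + t * u i := by
      intro t ht
      have := hfs _ (indicator_add_mem_newtonPolyhedron he₀
        (x := t • (Pi.single i 1 : σ → ℝ)) (smul_nonneg ht (by simp)))
      rw [map_add, map_smul, smul_eq_mul] at this
      rw [hy]
      convert! this
    have h1 := key ((f y - s) / (-u i)) (div_nonneg (by have := key 0 le_rfl; linarith)
      (by linarith))
    have h2 : (f y - s) / (-u i) * u i = -(f y - s) := by
      rw [div_neg, neg_mul, div_mul_cancel₀ _ hi.ne]
    linarith
  have hs : 0 < s := by
    refine lt_of_le_of_lt ?_ hfa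
    rw [hf]
    exact Finset.sum_nonneg fun i _ => mul_nonneg (ha i) (hu0 i)
  have hmem : (fun i => u i / s) ∈ C.coveringPolyhedron := by
    refine ⟨fun i => div_nonneg (hu0 i) hs.le, fun e he => ?_⟩
    have := hfs _ (indicator_add_mem_newtonPolyhedron he (le_refl 0))
    rw [add_zero, hf] at this
    rw [← Finset.sum_div, le_div_iff₀ hs, one_mul]
    refine this.le.trans_eq ?_
    simp [Finset.sum_ite_mem]
  have h1 := h _ hmem
  simp only [mul_div_assoc', ← Finset.sum_div] at h1
  rw [le_div_iff₀ hs, one_mul, ← hf] at h1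
  linarith

/-- A homogeneous, unbundled form of `mem_newtonPolyhedron`: a fractional packing of the edges. -/
theorem exists_fractional_packing {C : Clutter σ} (hC : C.edges.Nonempty) {a : σ → ℝ}
    (ha : 0 ≤ a) {r : ℝ} (hr : 0 ≤ r) (h : ∀ u ∈ C.coveringPolyhedron, r ≤ ∑ i, a i * u i) :
    ∃ w : Finset σ → ℝ, (∀ e, 0 ≤ w e) ∧ (∀ e ∉ C.edges, w e = 0) ∧ ∑ e, w e = r ∧
      ∀ i, loadMap σ w i ≤ a i := by
  rcases hr.eq_or_lt with rfl | hr
  · exact ⟨0, fun _ => le_rfl, fun _ _ => rfl, by simp, fun i => by simpa using ha i⟩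
  obtain ⟨_, ⟨w, ⟨hw, hwE⟩, rfl⟩, y, hy, hsum⟩ := mem_newtonPolyhedron hC
    (a := r⁻¹ • a) (smul_nonneg (inv_nonneg.mpr hr.le) ha) (fun u hu => by
      have : ∑ i, (r⁻¹ • a) i * u i = r⁻¹ * ∑ i, a i * u i := by
        rw [Finset.mul_sum]
        exact Finset.sum_congr rfl fun i _ => by simp [mul_assoc]
      rw [this, le_inv_mul_iff₀ hr, mul_one]
      exact h u hu)
  refine ⟨r • w, fun e => mul_nonneg hr.le (hw.1 e), fun e he => ?_, ?_, fun i => ?_⟩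
  · simp [hwE e he]
  · simp [← Finset.mul_sum, hw.2]
  · have h1 := congrFun hsum i
    have h2 : 0 ≤ y i := hy i
    simp only [Pi.add_apply, Pi.smul_apply, smul_eq_mul] at h1
    rw [map_smul, Pi.smul_apply, smul_eq_mul, ← le_inv_mul_iff₀ hr]
    linarith

end Duality

end Clutter

/-! ### Integral closure of ideals in Noetherian domains -/

/-- In a Noetherian domain, `x` is integral over `J` as soon as `c * x ^ k ∈ J ^ k` for all `k` and
one fixed `c ≠ 0`: the element `x T` is then almost integral over the Rees algebra `R[JT]`, hence
integral, and the degree `m` part of a monic equation of degree `m` is an equation of integral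
dependence over `J`. -/
theorem Ideal.mem_integralClosureSet_of_forall_mul_pow_mem {R : Type*} [CommRing R] [IsDomain R]
    [IsNoetherianRing R] {J : Ideal R} {c x : R} (hc : c ≠ 0) (h : ∀ k, c * x ^ k ∈ J ^ k) :
    x ∈ J.integralClosureSet := by
  have hC : Polynomial.C c ∈ reesAlgebra J := by
    rw [← Polynomial.monomial_zero_left]
    exact reesAlgebra.monomial_mem.mpr (by simp)
  have halm : IsAlmostIntegral (reesAlgebra J) (Polynomial.monomial 1 x) := by
    refine ⟨⟨Polynomial.C c, hC⟩, ?_, fun k => ?_⟩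
    · rw [mem_nonZeroDivisors_iff_ne_zero]
      simpa [Subtype.ext_iff] using hc
    · refine ⟨⟨Polynomial.monomial k (c * x ^ k), reesAlgebra.monomial_mem.mpr (h k)⟩, ?_⟩
      rw [Algebra.smul_def]
      simp [Polynomial.monomial_pow, Polynomial.C_mul_monomial]
  obtain ⟨p, hp, hpx⟩ := halm.isIntegral
  set m := p.natDegree with hm
  have hm1 : 1 ≤ m := by
    by_contra! hlt
    have hp1 : p = 1 := hp.natDegree_eq_zero.mp (by omega)
    simp [hp1] at hpx
  refine ⟨m, fun i => (p.coeff (m - i) : Polynomial R).coeff i, hm1,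
    fun i _ => (p.coeff (m - i)).2 i, ?_⟩
  have hcoef := congrArg (fun q => Polynomial.coeff q m) hpx
  simp only [Polynomial.eval₂_eq_sum_range, ← hm, Polynomial.finsetSum_coeff,
    Polynomial.monomial_pow, one_mul, Polynomial.coeff_zero] at hcoef
  rw [← Finset.sum_range_reflect] at hcoef
  have hrange : Finset.range (m + 1) = insert 0 (Finset.Icc 1 m) := by
    ext i
    simp only [Finset.mem_range, Finset.mem_insert, Finset.mem_Icc]
    omega
  have hterm : ∀ i ∈ Finset.range (m + 1),
      (algebraMap (reesAlgebra J) (Polynomial R) (p.coeff (m + 1 - 1 - i)) *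
        Polynomial.monomial (m + 1 - 1 - i) (x ^ (m + 1 - 1 - i))).coeff m =
      (p.coeff (m - i) : Polynomial R).coeff i * x ^ (m - i) := by
    intro i hi
    have him : i ≤ m := Nat.lt_succ_iff.mp (Finset.mem_range.mp hi)
    rw [Nat.add_sub_cancel]
    conv_lhs => rw [show m = i + (m - i) by omega]
    rw [show i + (m - i) - i = m - i by omega, Polynomial.coeff_mul_monomial]
    rfl
  rw [Finset.sum_congr rfl hterm, hrange, Finset.sum_insert (by simp)] at hcoef
  have hlead : p.coeff m = 1 := hp.coeff_natDegree
  simpa [hlead] using hcoef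

/-! ### Monomial ideals cut out by a linear weight -/

namespace MvPolynomial

theorem exists_add_of_mem_support_mul {σ K : Type*} [Field K]
    {f g : MvPolynomial σ K} {b : σ →₀ ℕ}
    (hb : b ∈ (f * g).support) : ∃ b₁ ∈ f.support, ∃ b₂ ∈ g.support, b₁ + b₂ = b := by
  classical
  exact Finset.mem_add.mp (support_mul f g hb)

variable {σ K : Type*} [Fintype σ] [Field K]

/-- The real weight `⟨b, u⟩` of an exponent vector. -/
def expWeight (u : σ → ℝ) (b : σ →₀ ℕ) : ℝ :=
  ∑ i, (b i : ℝ) * u i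

theorem expWeight_add (u : σ → ℝ) (b d : σ →₀ ℕ) :
    expWeight u (b + d) = expWeight u b + expWeight u d := by
  simp [expWeight, add_mul, Finset.sum_add_distrib]

theorem expWeight_nsmul (u : σ → ℝ) (k : ℕ) (b : σ →₀ ℕ) :
    expWeight u (k • b) = k * expWeight u b := by
  simp [expWeight, mul_assoc, Finset.mul_sum]

theorem expWeight_nonneg {u : σ → ℝ} (hu : ∀ i, 0 ≤ u i) (b : σ →₀ ℕ) : 0 ≤ expWeight u b :=
  Finset.sum_nonneg fun i _ => mul_nonneg (Nat.cast_nonneg _) (hu i)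

/-- The monomial ideal of the polynomials all of whose exponents have `u`-weight at least `c`. -/
def weightIdeal (K : Type*) [Field K] (u : σ → ℝ) (hu : ∀ i, 0 ≤ u i) (c : ℝ) :
    Ideal (MvPolynomial σ K) where
  carrier := {f | ∀ b ∈ f.support, c ≤ expWeight u b}
  zero_mem' := by simp
  add_mem' := by
    classical
    intro f g hf hg b hb
    rcases Finset.mem_union.mp (support_add hb) with h | h
    exacts [hf b h, hg b h]
  smul_mem' := by
    intro f g hg b hb
    obtain ⟨b₁, -, b₂, h₂, rfl⟩ := exists_add_of_mem_support_mul hb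
    rw [expWeight_add]
    linarith [hg b₂ h₂, expWeight_nonneg hu b₁]

variable {u : σ → ℝ} {hu : ∀ i, 0 ≤ u i} {c d : ℝ} {f g : MvPolynomial σ K}

theorem mem_weightIdeal : f ∈ weightIdeal K u hu c ↔ ∀ b ∈ f.support, c ≤ expWeight u b :=
  Iff.rfl

theorem monomial_mem_weightIdeal {b : σ →₀ ℕ} :
    monomial b (1 : K) ∈ weightIdeal K u hu c ↔ c ≤ expWeight u b := by
  classical
  rw [mem_weightIdeal, support_monomial, if_neg one_ne_zero]
  simp

theorem mul_mem_weightIdeal (hf : f ∈ weightIdeal K u hu c) (hg : g ∈ weightIdeal K u hu d) :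
    f * g ∈ weightIdeal K u hu (c + d) := by
  intro b hb
  obtain ⟨b₁, h₁, b₂, h₂, rfl⟩ := exists_add_of_mem_support_mul hb
  rw [expWeight_add]
  exact add_le_add (hf b₁ h₁) (hg b₂ h₂)

theorem pow_le_weightIdeal {J : Ideal (MvPolynomial σ K)} (hJ : J ≤ weightIdeal K u hu c)
    (k : ℕ) : J ^ k ≤ weightIdeal K u hu (k * c) := by
  induction k with
  | zero =>
    intro f _ b _
    simpa using expWeight_nonneg hu b
  | succ k ih =>
    rw [pow_succ, Ideal.mul_le]
    intro f hf g hg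
    have := mul_mem_weightIdeal (ih hf) (hJ hg)
    convert! this using 2
    push_cast
    ring

theorem pow_mem_weightIdeal (hf : f ∈ weightIdeal K u hu c) (k : ℕ) :
    f ^ k ∈ weightIdeal K u hu (k * c) :=
  pow_le_weightIdeal le_rfl k (Ideal.pow_mem_pow hf k)

/-- A monomial that is integral over `J`, where `J` lies in a weight ideal, lies in that weight
ideal: compare the coefficients of the pure power in an equation of integral dependence. -/
theorem le_expWeight_of_monomial_mem_integralClosureSet {J : Ideal (MvPolynomial σ K)}
    (hJ : J ≤ weightIdeal K u hu c) {b : σ →₀ ℕ}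
    (hb : monomial b (1 : K) ∈ J.integralClosureSet) : c ≤ expWeight u b := by
  classical
  obtain ⟨m, a, hm, ha, h⟩ := hb
  have hcoef := congrArg (coeff (m • b)) h
  rw [coeff_add, coeff_sum, monomial_pow, one_pow, coeff_monomial, if_pos rfl, coeff_zero] at hcoef
  obtain ⟨i, hi, hne⟩ : ∃ i ∈ Finset.Icc 1 m,
      coeff (m • b) (a i * monomial b (1 : K) ^ (m - i)) ≠ 0 := by
    by_contra! h0
    rw [Finset.sum_eq_zero h0, add_zero] at hcoef
    exact one_ne_zero hcoef
  have him := Finset.mem_Icc.mp hi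
  have hsplit : m • b = i • b + (m - i) • b := by
    rw [← add_nsmul]
    congr 1
    omega
  rw [monomial_pow, one_pow, hsplit, coeff_mul_monomial, mul_one] at hne
  have hle := pow_le_weightIdeal hJ i (ha i hi) _ (mem_support_iff.mpr hne)
  rw [expWeight_nsmul] at hle
  exact le_of_mul_le_mul_left hle (by exact_mod_cast him.1)

end MvPolynomial

/-! ### Edge ideals -/

section SquarefreeMonomial

variable {σ K : Type*} [Field K]

/-- The exponent vector of the squarefree monomial with support `e`. -/
noncomputable def squarefreeExp (e : Finset σ) : σ →₀ ℕ :=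
  ∑ i ∈ e, Finsupp.single i 1

theorem squarefreeMonomial_eq_monomial (e : Finset σ) :
    squarefreeMonomial K e = monomial (squarefreeExp e) 1 :=
  (monomial_sum_one e fun i => Finsupp.single i 1).symm

open Classical in
theorem squarefreeExp_apply (e : Finset σ) (i : σ) :
    squarefreeExp e i = if i ∈ e then 1 else 0 := by
  simp [squarefreeExp, Finsupp.finsetSum_apply, Finsupp.single_apply]

theorem squarefreeExp_le_iff {e : Finset σ} {b : σ →₀ ℕ} :
    squarefreeExp e ≤ b ↔ ∀ i ∈ e, b i ≠ 0 := by
  classical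
  simp only [Finsupp.le_def, squarefreeExp_apply]
  refine forall_congr' fun i => ?_
  split_ifs with h
  · simp [h, Nat.one_le_iff_ne_zero]
  · simp [h]

theorem squarefreeExp_le_squarefreeExp_iff {e e' : Finset σ} :
    squarefreeExp e ≤ squarefreeExp e' ↔ e ⊆ e' := by
  classical
  rw [squarefreeExp_le_iff]
  simp [squarefreeExp_apply, Finset.subset_iff]

theorem squarefreeMonomial_ne_zero (e : Finset σ) : squarefreeMonomial K e ≠ 0 := by
  simp [squarefreeMonomial_eq_monomial]

theorem squarefreeMonomial_mem_span_iff {E : Set (Finset σ)} {e : Finset σ} :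
    squarefreeMonomial K e ∈ Ideal.span (squarefreeMonomial K '' E) ↔ ∃ e' ∈ E, e' ⊆ e := by
  classical
  have himage : squarefreeMonomial K '' E =
      (fun b => monomial b (1 : K)) '' (squarefreeExp '' E) := by
    rw [Set.image_image]
    exact Set.image_congr fun e _ => squarefreeMonomial_eq_monomial e
  rw [himage, mem_ideal_span_monomial_image, squarefreeMonomial_eq_monomial, support_monomial,
    if_neg one_ne_zero]
  simp [squarefreeExp_le_squarefreeExp_iff]

theorem Clutter.squarefreeMonomial_mem_edgeIdeal {C : Clutter σ} {e : Finset σ}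
    (he : e ∈ C.edges) : squarefreeMonomial K e ∈ C.edgeIdeal K :=
  Ideal.subset_span ⟨e, he, rfl⟩

theorem Clutter.clutter_edgeIdeal (C : Clutter σ) : (C.edgeIdeal K).clutter = C := by
  refine Clutter.eq_of_edges_eq (Set.ext fun U => ?_)
  have hP : (fun e => squarefreeMonomial K e ∈ C.edgeIdeal K) = fun e => ∃ e' ∈ C.edges, e' ⊆ e :=
    funext fun e => propext squarefreeMonomial_mem_span_iff
  change Minimal (fun e => squarefreeMonomial K e ∈ C.edgeIdeal K) U ↔ _
  rw [hP, Clutter.minimal_exists_edge_subset_iff]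

theorem Ideal.IsSquarefreeMonomial.edgeIdeal_clutter {I : Ideal (MvPolynomial σ K)}
    (hI : I.IsSquarefreeMonomial) : I.clutter.edgeIdeal K = I := by
  refine le_antisymm (Ideal.span_le.mpr ?_) ?_
  · rintro _ ⟨e, he, rfl⟩
    exact he.1
  · obtain ⟨E, hE⟩ := hI
    conv_lhs => rw [hE]
    refine Ideal.span_le.mpr ?_
    rintro _ ⟨e, he, rfl⟩
    have heI : squarefreeMonomial K e ∈ I := hE ▸ Ideal.subset_span ⟨e, he, rfl⟩
    obtain ⟨e', he'e, he'⟩ := exists_minimal_le_of_wellFoundedLT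
      (fun e => squarefreeMonomial K e ∈ I) e heI
    exact squarefreeMonomial_mem_span_iff.mpr ⟨e', he', he'e⟩

end SquarefreeMonomial

namespace Clutter

variable {σ K : Type*} [Fintype σ] [Field K] {C : Clutter σ}

theorem expWeight_squarefreeExp (u : σ → ℝ) (e : Finset σ) :
    expWeight u (squarefreeExp e) = ∑ i ∈ e, u i := by
  classical
  simp [expWeight, squarefreeExp_apply, Finset.sum_ite_mem]

theorem edgeIdeal_le_weightIdeal {u : σ → ℝ} (hu : u ∈ C.coveringPolyhedron) :
    C.edgeIdeal K ≤ weightIdeal K u hu.1 1 := by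
  refine Ideal.span_le.mpr ?_
  rintro _ ⟨e, he, rfl⟩
  rw [squarefreeMonomial_eq_monomial]
  exact monomial_mem_weightIdeal.mpr ((hu.2 e he).trans_eq (expWeight_squarefreeExp u e).symm)

/-! ### Integral closures of powers of edge ideals -/

/-- The product of all edge monomials. It bounds, uniformly in the power, the error made when a
fractional packing of the edges is rounded down. -/
noncomputable def edgeProduct (K : Type*) [Field K] (C : Clutter σ) : MvPolynomial σ K :=
  ∏ e ∈ C.edges.toFinite.toFinset, squarefreeMonomial K e

theorem edgeProduct_ne_zero (C : Clutter σ) : C.edgeProduct K ≠ 0 :=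
  Finset.prod_ne_zero_iff.mpr fun e _ => squarefreeMonomial_ne_zero e

theorem edgeProduct_mul_monomial_mem (hC : C.edges.Nonempty) {b : σ →₀ ℕ} {r : ℕ}
    (h : ∀ u ∈ C.coveringPolyhedron, (r : ℝ) ≤ expWeight u b) :
    C.edgeProduct K * monomial b 1 ∈ C.edgeIdeal K ^ r := by
  classical
  obtain ⟨w, hw0, hwE, hwr, hwb⟩ := exists_fractional_packing hC (a := fun i => (b i : ℝ))
    (fun i => Nat.cast_nonneg _) (Nat.cast_nonneg r) h
  set E := C.edges.toFinite.toFinset with hE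
  have hmemE : ∀ e, e ∈ E ↔ e ∈ C.edges := fun e => Set.Finite.mem_toFinset _
  have hwsum : ∑ e ∈ E, w e = r := by
    rw [← hwr]
    exact Finset.sum_subset (Finset.subset_univ _) fun e _ he => hwE e fun h => he ((hmemE e).mpr h)
  have hdvd : ∏ e ∈ E, squarefreeMonomial K e ^ ⌊w e⌋₊ ∣ monomial b 1 := by
    have hprod : ∏ e ∈ E, squarefreeMonomial K e ^ ⌊w e⌋₊ =
        monomial (∑ e ∈ E, ⌊w e⌋₊ • squarefreeExp e) 1 := by
      rw [monomial_sum_one]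
      refine Finset.prod_congr rfl fun e _ => ?_
      rw [squarefreeMonomial_eq_monomial, monomial_pow, one_pow]
    rw [hprod, monomial_one_dvd_monomial_one]
    intro i
    have : ((∑ e ∈ E, ⌊w e⌋₊ • squarefreeExp e) i : ℝ) ≤ b i := by
      refine le_trans ?_ (hwb i)
      simp only [Finsupp.finsetSum_apply, Finsupp.smul_apply, squarefreeExp_apply, smul_eq_mul,
        mul_ite, mul_one, mul_zero, loadMap, LinearMap.coe_mk, AddHom.coe_mk]
      push_cast
      refine (Finset.sum_le_sum (g := fun e => if i ∈ e then w e else 0) fun e _ => ?_).trans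
        (Finset.sum_le_univ_sum_of_nonneg fun e => ?_)
      · split_ifs
        exacts [Nat.floor_le (hw0 e), le_rfl]
      · split_ifs
        exacts [hw0 e, le_rfl]
    exact_mod_cast this
  have hpow : ∏ e ∈ E, squarefreeMonomial K e ^ (⌊w e⌋₊ + 1) ∈ C.edgeIdeal K ^ r := by
    refine Ideal.pow_le_pow_right (I := C.edgeIdeal K) (n := ∑ e ∈ E, (⌊w e⌋₊ + 1)) ?_ ?_
    · have : (r : ℝ) ≤ ∑ e ∈ E, ((⌊w e⌋₊ : ℝ) + 1) := by
        rw [← hwsum]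
        exact Finset.sum_le_sum fun e _ => (Nat.lt_floor_add_one _).le
      exact_mod_cast this
    · rw [← Finset.prod_pow_eq_pow_sum]
      exact Ideal.prod_mem_prod fun e he =>
        Ideal.pow_mem_pow (squarefreeMonomial_mem_edgeIdeal ((hmemE e).mp he)) _
  refine Ideal.mem_of_dvd _ ?_ hpow
  simp only [pow_succ, Finset.prod_mul_distrib]
  rw [mul_comm]
  exact mul_dvd_mul_left _ hdvd

theorem edgeProduct_mul_mem (hC : C.edges.Nonempty) {f : MvPolynomial σ K} {r : ℕ}
    (h : ∀ u (hu : u ∈ C.coveringPolyhedron), f ∈ weightIdeal K u hu.1 r) :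
    C.edgeProduct K * f ∈ C.edgeIdeal K ^ r := by
  rw [f.as_sum, Finset.mul_sum]
  refine Ideal.sum_mem _ fun b hb => ?_
  have : monomial b (coeff b f) = monomial b 1 * MvPolynomial.C (coeff b f) := by
    rw [mul_comm, C_mul_monomial, mul_one]
  rw [this, ← mul_assoc]
  exact Ideal.mul_mem_right _ _ (edgeProduct_mul_monomial_mem hC fun u hu => h u hu b hb)

/-- The integral closure of a power of the edge ideal contains every polynomial whose exponents
satisfy the inequalities given by the fractional vertex covers. -/
theorem mem_integralClosureSet_edgeIdeal_pow (hC : C.edges.Nonempty) {f : MvPolynomial σ K}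
    {r : ℕ} (h : ∀ u (hu : u ∈ C.coveringPolyhedron), f ∈ weightIdeal K u hu.1 r) :
    f ∈ (C.edgeIdeal K ^ r).integralClosureSet := by
  refine Ideal.mem_integralClosureSet_of_forall_mul_pow_mem C.edgeProduct_ne_zero fun k => ?_
  rw [← pow_mul, mul_comm r k]
  refine edgeProduct_mul_mem hC fun u hu => ?_
  rw [Nat.cast_mul]
  exact pow_mem_weightIdeal (h u hu) k

theorem le_expWeight_of_mem_integralClosureSet {b : σ →₀ ℕ} {r : ℕ} {u : σ → ℝ}
    (hu : u ∈ C.coveringPolyhedron)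
    (hb : monomial b (1 : K) ∈ (C.edgeIdeal K ^ r).integralClosureSet) :
    (r : ℝ) ≤ expWeight u b := by
  refine le_expWeight_of_monomial_mem_integralClosureSet (hu := hu.1) ?_ hb
  simpa using pow_le_weightIdeal (edgeIdeal_le_weightIdeal (K := K) hu) r

end Clutter

namespace Clutter

/-! ### Symbolic powers of edge ideals -/

section Symbolic

variable {σ K : Type*} [Field K]

open Classical in
/-- The characteristic vector of a set of vertices. -/
noncomputable def coverVector (U : Finset σ) (i : σ) : ℝ :=
  if i ∈ U then 1 else 0

theorem coverVector_nonneg (U : Finset σ) (i : σ) : 0 ≤ coverVector U i := by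
  unfold coverVector
  split_ifs <;> simp

theorem IsVertexCover.coverVector_mem {C : Clutter σ} {U : Finset σ} (hU : C.IsVertexCover U) :
    coverVector U ∈ C.coveringPolyhedron := by
  classical
  refine ⟨coverVector_nonneg U, fun e he => ?_⟩
  obtain ⟨i, hie, hiU⟩ := hU e he
  refine le_trans ?_ (Finset.single_le_sum (fun j _ => coverVector_nonneg U j) hie)
  simp [coverVector, hiU]

theorem X_mem_span_X_iff {U : Finset σ} {i : σ} :
    (X i : MvPolynomial σ K) ∈ Ideal.span (X '' (U : Set σ)) ↔ i ∈ U := by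
  classical
  rw [mem_ideal_span_X_image, support_X]
  simp [Finsupp.single_apply]

theorem edgeIdeal_le_span_X {C : Clutter σ} {U : Finset σ} (hU : C.IsVertexCover U) :
    C.edgeIdeal K ≤ Ideal.span (X '' (U : Set σ)) := by
  refine Ideal.span_le.mpr ?_
  rintro _ ⟨e, he, rfl⟩
  obtain ⟨i, hie, hiU⟩ := hU e he
  exact Ideal.mem_of_dvd _ (Finset.dvd_prod_of_mem X hie) (Ideal.subset_span ⟨i, hiU, rfl⟩)

variable [Fintype σ]

theorem expWeight_coverVector (U : Finset σ) (b : σ →₀ ℕ) :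
    expWeight (coverVector U) b = ((∑ i ∈ U, b i : ℕ) : ℝ) := by
  classical
  simp [expWeight, coverVector, Finset.sum_ite_mem]

open Classical in
/-- The weight ideals of a characteristic vector are the level sets of a weighted order, which is
a valuation. -/
theorem mem_weightIdeal_coverVector_iff {U : Finset σ} {n : ℕ} {f : MvPolynomial σ K} :
    f ∈ weightIdeal K (coverVector U) (coverVector_nonneg U) n ↔
      n ≤ (f : MvPowerSeries σ K).weightedOrder fun i => if i ∈ U then 1 else 0 := by
  have hw : ∀ b : σ →₀ ℕ, Finsupp.weight (fun i => if i ∈ U then 1 else 0) b = ∑ i ∈ U, b i := by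
    intro b
    rw [Finsupp.weight_apply, Finsupp.sum_fintype _ _ (by simp)]
    simp [Finset.sum_ite_mem]
  rw [mem_weightIdeal]
  simp only [expWeight_coverVector, Nat.cast_le]
  constructor
  · intro h
    refine MvPowerSeries.nat_le_weightedOrder _ fun b hb => ?_
    rw [coeff_coe]
    by_contra hne
    exact absurd (h b (mem_support_iff.mpr hne)) (by rw [← hw]; omega)
  · intro h b hb
    have := h.trans (MvPowerSeries.weightedOrder_le _ (d := b)
      (by rwa [coeff_coe, ← mem_support_iff]))
    rw [hw] at this
    exact_mod_cast this

open Classical in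
theorem mem_span_X_iff {U : Finset σ} {f : MvPolynomial σ K} :
    f ∈ Ideal.span (X '' (U : Set σ)) ↔
      (f : MvPowerSeries σ K).weightedOrder (fun i => if i ∈ U then 1 else 0) ≠ 0 := by
  rw [← Order.one_le_iff_ne_zero, ← Nat.cast_one, ← mem_weightIdeal_coverVector_iff,
    mem_ideal_span_X_image, mem_weightIdeal]
  simp only [expWeight_coverVector, Nat.cast_le, Finset.mem_coe]
  refine forall₂_congr fun b _ => ?_
  rw [Nat.one_le_iff_ne_zero, Ne, Finset.sum_eq_zero_iff]
  push Not
  rfl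

theorem isPrime_span_X (K : Type*) [Field K] (U : Finset σ) :
    (Ideal.span (X '' (U : Set σ)) : Ideal (MvPolynomial σ K)).IsPrime := by
  classical
  refine ⟨(Ideal.ne_top_iff_one _).mpr fun h => ?_, fun {f g} h => ?_⟩
  · obtain ⟨i, -, hi⟩ := mem_ideal_span_X_image.mp h 0 (by simp)
    exact hi rfl
  · simp only [mem_span_X_iff, coe_mul, MvPowerSeries.weightedOrder_mul] at h ⊢
    by_contra! h0
    exact h (by rw [h0.1, h0.2, add_zero])

open Classical in
/-- The variables in a prime ideal containing the edge ideal form a vertex cover. -/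
theorem isVertexCover_filter_X_mem {C : Clutter σ} {p : Ideal (MvPolynomial σ K)} (hp : p.IsPrime)
    (h : C.edgeIdeal K ≤ p) :
    C.IsVertexCover (Finset.univ.filter fun i => (X i : MvPolynomial σ K) ∈ p) := by
  intro e he
  obtain ⟨i, hie, hip⟩ := (hp.prod_mem_iff).mp (h (squarefreeMonomial_mem_edgeIdeal (K := K) he))
  exact ⟨i, hie, by simpa using hip⟩

/-- The minimal primes of the edge ideal are generated by the minimal vertex covers. -/
theorem mem_minimalPrimes_edgeIdeal_iff {C : Clutter σ} {p : Ideal (MvPolynomial σ K)} :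
    p ∈ (C.edgeIdeal K).minimalPrimes ↔
      ∃ U ∈ C.blocker.edges, p = Ideal.span (X '' (U : Set σ)) := by
  classical
  constructor
  · intro hp
    obtain ⟨U, hU, hUp⟩ := (isVertexCover_filter_X_mem hp.1.1 hp.1.2).exists_blocker_subset
    have hle : Ideal.span (X '' (U : Set σ)) ≤ p := by
      refine Ideal.span_le.mpr ?_
      rintro _ ⟨i, hi, rfl⟩
      simpa using hUp hi
    exact ⟨U, hU, le_antisymm (hp.2 ⟨isPrime_span_X K U, edgeIdeal_le_span_X hU.1⟩ hle) hle⟩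
  · rintro ⟨U, hU, rfl⟩
    refine ⟨⟨isPrime_span_X K U, edgeIdeal_le_span_X hU.1⟩, fun q hq hqU => ?_⟩
    have hsub : (Finset.univ.filter fun i => (X i : MvPolynomial σ K) ∈ q) ⊆ U := by
      intro i hi
      exact X_mem_span_X_iff.mp (hqU (Finset.mem_filter.mp hi).2)
    have hUq := hU.2 (isVertexCover_filter_X_mem hq.1 hq.2) hsub
    refine Ideal.span_le.mpr ?_
    rintro _ ⟨i, hi, rfl⟩
    exact (Finset.mem_filter.mp (hUq hi)).2

/-- The exponents of an element of the `n`-th symbolic power have weight at least `n` on every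
minimal vertex cover: multiplying by an element outside the corresponding minimal prime, which has
order `0`, does not change the order. -/
theorem mem_weightIdeal_of_mem_symbolicPower {C : Clutter σ} {n : ℕ} {f : MvPolynomial σ K}
    (hf : f ∈ (C.edgeIdeal K).symbolicPower n) {U : Finset σ} (hU : U ∈ C.blocker.edges) :
    f ∈ weightIdeal K (coverVector U) (coverVector_nonneg U) n := by
  classical
  obtain ⟨g, hg, hgf⟩ := hf _ (mem_minimalPrimes_edgeIdeal_iff.mpr ⟨U, hU, rfl⟩)
  have hmem := pow_le_weightIdeal (edgeIdeal_le_weightIdeal (K := K) hU.1.coverVector_mem) n hgf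
  rw [mul_one, mem_weightIdeal_coverVector_iff, coe_mul, MvPowerSeries.weightedOrder_mul] at hmem
  rw [mem_span_X_iff, not_not] at hg
  rw [hg, zero_add] at hmem
  exact mem_weightIdeal_coverVector_iff.mpr hmem

/-- Conversely, a monomial of weight at least `n` on every minimal vertex cover `U` lies in the
`n`-th symbolic power. Every `X i` with `i ∈ U` becomes an edge monomial after multiplication by
the variables of an edge that meets `U` only in `i`, and these variables lie outside the prime of
`U`. -/
theorem monomial_mem_symbolicPower {C : Clutter σ} {n : ℕ} {b : σ →₀ ℕ}
    (hb : ∀ U ∈ C.blocker.edges, n ≤ ∑ i ∈ U, b i) :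
    monomial b (1 : K) ∈ (C.edgeIdeal K).symbolicPower n := by
  classical
  intro p hp
  obtain ⟨U, hU, rfl⟩ := mem_minimalPrimes_edgeIdeal_iff.mp hp
  have hprime := isPrime_span_X K U
  choose! e heC hie heU using fun i (hi : i ∈ U) => exists_edge_inter_eq_of_mem_blocker hU hi
  refine ⟨∏ i ∈ U, squarefreeMonomial K ((e i).erase i) ^ b i, fun hmem => ?_, ?_⟩
  · obtain ⟨i, hi, hpow⟩ := hprime.prod_mem_iff.mp hmem
    obtain ⟨j, hj, hjX⟩ := hprime.prod_mem_iff.mp (hprime.mem_of_pow_mem _ hpow)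
    obtain ⟨hji, hje⟩ := Finset.mem_erase.mp hj
    exact hji (heU i hi j hje (X_mem_span_X_iff.mp hjX))
  · have hmon : ∏ i ∈ U, (X i : MvPolynomial σ K) ^ b i ∣ monomial b 1 := by
      rw [monomial_eq, C_1, one_mul, Finsupp.prod_fintype _ _ (by simp)]
      exact Finset.prod_dvd_prod_of_subset _ _ _ (Finset.subset_univ U)
    refine Ideal.mem_of_dvd _ (mul_dvd_mul_left _ hmon) ?_
    rw [← Finset.prod_mul_distrib]
    refine Ideal.pow_le_pow_right (hb U hU) ?_
    rw [← Finset.prod_pow_eq_pow_sum]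
    refine Ideal.prod_mem_prod fun i hi => ?_
    rw [← mul_pow, squarefreeMonomial, Finset.prod_erase_mul _ _ (hie i hi)]
    exact Ideal.pow_mem_pow (squarefreeMonomial_mem_edgeIdeal (heC i hi)) _

end Symbolic

/-! ### The ic-resurgence as the reciprocal of a minimum -/

section Resurgence

variable {σ K : Type*} [Fintype σ] [Field K] {C : Clutter σ}

/-- If `m` is a lower bound for the pairing of the two covering polyhedra, then every ratio in the
definition of the ic-resurgence satisfies `m * n < r`. -/
theorem mul_lt_of_not_symbolicPower_subset (hC : C.edges.Nonempty) {m : ℝ}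
    (hm : ∀ x ∈ C.coveringPolyhedron, ∀ y ∈ C.blocker.coveringPolyhedron, m ≤ ∑ i, x i * y i)
    {n r : ℕ} (hn : 1 ≤ n)
    (h : ¬ (((C.edgeIdeal K).symbolicPower n : Set (MvPolynomial σ K)) ⊆
      (C.edgeIdeal K ^ r).integralClosureSet)) : m * n < r := by
  by_contra! hle
  refine h fun f hf => mem_integralClosureSet_edgeIdeal_pow hC fun u hu b hb => ?_
  have hn0 : (0 : ℝ) < n := by exact_mod_cast hn
  have hy : (fun i => (b i : ℝ) / n) ∈ C.blocker.coveringPolyhedron := by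
    refine ⟨fun i => by positivity, fun U hU => ?_⟩
    rw [← Finset.sum_div, le_div_iff₀ hn0, one_mul]
    have := mem_weightIdeal_of_mem_symbolicPower hf hU b hb
    rw [expWeight_coverVector] at this
    exact_mod_cast this
  have hpair := hm u hu _ hy
  have hsum : ∑ i, u i * ((b i : ℝ) / n) = expWeight u b / n := by
    rw [expWeight, Finset.sum_div]
    exact Finset.sum_congr rfl fun i _ => by ring
  rw [hsum, le_div_iff₀ hn0] at hpair
  exact hle.trans hpair

/-- Rounding up `k • v` for a fractional cover `v` of the blocker gives ratios approaching the
reciprocal of `⟨u, v⟩`. -/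
theorem exists_mem_icRatios_gt {u v : σ → ℝ} (hu : u ∈ C.coveringPolyhedron)
    (hv : v ∈ C.blocker.coveringPolyhedron) {t : ℝ} (ht : t < 1 / ∑ i, u i * v i) :
    ∃ q ∈ (C.edgeIdeal K).icRatios, t < q := by
  set m := ∑ i, u i * v i with hm
  have hmpos : 0 < m := sum_mul_pos hu hv
  set s := ∑ i, u i with hs
  have hs0 : 0 ≤ s := Finset.sum_nonneg fun i _ => hu.1 i
  have htm : 0 < 1 - t * m := by
    rw [lt_div_iff₀ hmpos] at ht
    linarith
  -- `k` is chosen so that `t * (k * m + s + 1) < k`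
  obtain ⟨k, hk⟩ := exists_nat_gt (max 0 (t * (s + 1) / (1 - t * m)))
  have hk0 : (0 : ℝ) < k := (le_max_left _ _).trans_lt hk
  have hkt : t * (k * m + s + 1) < k := by
    have := (le_max_right _ _).trans_lt hk
    rw [div_lt_iff₀ htm] at this
    linarith
  set b : σ →₀ ℕ := Finsupp.equivFunOnFinite.symm fun i => ⌈k * v i⌉₊ with hb
  have hbi : ∀ i, b i = ⌈k * v i⌉₊ := fun i => rfl
  set r := ⌊expWeight u b⌋₊ + 1 with hr
  have hbu : expWeight u b ≤ k * m + s := by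
    rw [hm, hs, Finset.mul_sum, ← Finset.sum_add_distrib]
    refine Finset.sum_le_sum fun i _ => ?_
    have h1 : (b i : ℝ) ≤ k * v i + 1 := by
      rw [hbi]
      exact (Nat.ceil_lt_add_one (mul_nonneg hk0.le (hv.1 i))).le
    have := mul_le_mul_of_nonneg_right h1 (hu.1 i)
    linarith
  have hrle : (r : ℝ) ≤ k * m + s + 1 := by
    rw [hr]
    push_cast
    linarith [Nat.floor_le (expWeight_nonneg hu.1 b)]
  have hr0 : (0 : ℝ) < r := by positivity
  refine ⟨k / r, ⟨k, r, by exact_mod_cast hk0, by omega, fun hsub => ?_, rfl⟩, ?_⟩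
  · have hmem : monomial b (1 : K) ∈ (C.edgeIdeal K).symbolicPower k := by
      refine monomial_mem_symbolicPower fun U hU => ?_
      have : (k : ℝ) ≤ ∑ i ∈ U, (b i : ℝ) := by
        calc (k : ℝ) ≤ k * ∑ i ∈ U, v i := le_mul_of_one_le_right hk0.le (hv.2 U hU)
          _ = ∑ i ∈ U, k * v i := Finset.mul_sum _ _ _
          _ ≤ _ := Finset.sum_le_sum fun i _ => Nat.le_ceil _
      exact_mod_cast this
    have h1 := le_expWeight_of_mem_integralClosureSet hu (hsub hmem)
    have h2 := Nat.lt_floor_add_one (expWeight u b)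
    rw [hr] at h1
    push_cast at h1
    linarith
  · rw [lt_div_iff₀ hr0]
    rcases le_or_gt t 0 with ht0 | ht0
    · exact (mul_nonpos_of_nonpos_of_nonneg ht0 hr0.le).trans_lt hk0
    · exact (mul_le_mul_of_nonneg_left hrle ht0.le).trans_lt hkt

/-- The ic-resurgence of an edge ideal is a finite supremum, and its reciprocal is the least value
of the pairing on pairs of vertices of the covering polyhedra of the clutter and its blocker. -/
theorem isLUB_icRatios_and_isLeast (K : Type*) [Field K] (hC : ∅ ∉ C.edges)
    (hC' : C.edges.Nonempty) :
    IsLUB (C.edgeIdeal K).icRatios (C.edgeIdeal K).icResurgence ∧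
      IsLeast {c : ℝ | ∃ u ∈ C.coveringPolyhedron.extremePoints ℝ,
        ∃ v ∈ C.blocker.coveringPolyhedron.extremePoints ℝ, c = ∑ i, u i * v i}
        (1 / (C.edgeIdeal K).icResurgence) := by
  obtain ⟨u, hu, v, hv, hmin⟩ :=
    exists_extremePoints_forall_sum_le hC (empty_notMem_blocker_edges hC')
  have hmpos := sum_mul_pos hu.1 hv.1
  have hlub : IsLUB (C.edgeIdeal K).icRatios (1 / ∑ i, u i * v i) := by
    refine ⟨?_, fun t ht => ?_⟩
    · rintro _ ⟨n, r, hn, hr, h, rfl⟩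
      have hlt := mul_lt_of_not_symbolicPower_subset hC' hmin hn h
      have hr0 : (0 : ℝ) < r := by exact_mod_cast hr
      rw [div_le_div_iff₀ hr0 hmpos]
      linarith
    · by_contra! hlt
      obtain ⟨q, hq, htq⟩ := exists_mem_icRatios_gt (K := K) hu.1 hv.1 hlt
      exact absurd (ht hq) (not_le.mpr htq)
  have hne : (C.edgeIdeal K).icRatios.Nonempty := by
    obtain ⟨q, hq, -⟩ := exists_mem_icRatios_gt (K := K) hu.1 hv.1 (sub_one_lt _)
    exact ⟨q, hq⟩
  have hres : (C.edgeIdeal K).icResurgence = 1 / ∑ i, u i * v i := hlub.csSup_eq hne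
  refine ⟨hres ▸ hlub, ?_⟩
  rw [hres, one_div_one_div]
  refine ⟨⟨u, hu, v, hv, rfl⟩, ?_⟩
  rintro _ ⟨x, hx, y, hy, rfl⟩
  exact hmin x hx.1 y hy.1

/-- Passing to the blocker exchanges the two covering polyhedra, so it does not change the least
value of the pairing. -/
theorem icResurgence_edgeIdeal_blocker (K : Type*) [Field K] (hC : ∅ ∉ C.edges)
    (hC' : C.edges.Nonempty) :
    (C.edgeIdeal K).icResurgence = (C.blocker.edgeIdeal K).icResurgence := by
  have h1 := (isLUB_icRatios_and_isLeast K hC hC').2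
  have h2 := (isLUB_icRatios_and_isLeast K (empty_notMem_blocker_edges hC')
    (blocker_edges_nonempty hC)).2
  rw [blocker_blocker] at h2
  have hset : {c : ℝ | ∃ u ∈ C.coveringPolyhedron.extremePoints ℝ,
        ∃ v ∈ C.blocker.coveringPolyhedron.extremePoints ℝ, c = ∑ i, u i * v i} =
      {c : ℝ | ∃ u ∈ C.blocker.coveringPolyhedron.extremePoints ℝ,
        ∃ v ∈ C.coveringPolyhedron.extremePoints ℝ, c = ∑ i, u i * v i} := by
    ext c
    constructor <;> rintro ⟨u, hu, v, hv, rfl⟩ <;>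
      exact ⟨v, hv, u, hu, Finset.sum_congr rfl fun i _ => mul_comm _ _⟩
  rw [hset] at h1
  simpa using h1.unique h2

end Resurgence

end Clutter

theorem mainTheorem1 {σ : Type*} [Fintype σ] {K : Type*} [Field K]
    (I : Ideal (MvPolynomial σ K)) (hI : I.IsSquarefreeMonomial) (hbot : I ≠ ⊥) (htop : I ≠ ⊤) :
    IsLUB I.icRatios I.icResurgence ∧
    IsLUB I.alexanderDual.icRatios I.alexanderDual.icResurgence ∧
    IsLeast {c : ℝ | ∃ u ∈ I.coveringVertices, ∃ v ∈ I.alexanderDual.coveringVertices,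
      c = ∑ i, u i * v i} (1 / I.icResurgence) ∧
    I.icResurgence = I.alexanderDual.icResurgence := by
  have hII := hI.edgeIdeal_clutter
  have hdual : I.alexanderDual.clutter = I.clutter.blocker := Clutter.clutter_edgeIdeal _
  have hC : ∅ ∉ I.clutter.edges := fun h =>
    htop ((Ideal.eq_top_iff_one I).mpr (by simpa [squarefreeMonomial] using h.1))
  have hC' : I.clutter.edges.Nonempty := by
    rw [Set.nonempty_iff_ne_empty]
    intro h
    exact hbot (by rw [← hII, Clutter.edgeIdeal, h, Set.image_empty, Ideal.span_empty])
  have h1 := Clutter.isLUB_icRatios_and_isLeast K hC hC'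
  have h2 := Clutter.isLUB_icRatios_and_isLeast K (Clutter.empty_notMem_blocker_edges hC')
    (Clutter.blocker_edges_nonempty hC)
  have h3 := Clutter.icResurgence_edgeIdeal_blocker K hC hC'
  rw [hII] at h1 h3
  have hQ : I.alexanderDual.coveringVertices =
      I.clutter.blocker.coveringPolyhedron.extremePoints ℝ := by
    rw [← hdual]
    rfl
  rw [hQ]
  exact ⟨h1.1, h2.1, h1.2, h3⟩
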